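/- Let $L\ge 2$ and let $P_1,\dots,P_L$ be probability distributions on a measurable space that are jointly irreducible: whenever $\sum_i\gamma_iP_i$ ($\gamma_i\in\mathbb R$) is a probability distribution, all $\gamma_i\ge 0$. Let $\pi_1,\dots,\pi_L\in\Delta_L=\{\mu\in\mathbb R^L:\mu_i\ge 0,\ \sum_i\mu_i=1\}$ be linearly independent and $\tilde P_i=\sum_j\pi_{i,j}P_j$. Then, with probability $1$, $\mathrm{Demix}(\tilde P_1,\dots,\tilde P_L)$ terminates (with every step well defined) and returns a permutation of $(P_1,\dots,P_L)$. Here, for distributions $F_0, F_1$, $\kappa^*(F_0\,|\,F_1)$ is the maximum of the $\kappa\in[0,1]$ such that $F_0=(1-\kappa)G+\kappa F_1$ for some distribution $G$. If $F_0\neq F_1$, then $\mathrm{Residue}(F_0\,|\,F_1)=(F_0-\kappa F_1)/(1-\kappa)$ with $\kappa=\kappa^*(F_0\,|\,F_1)$; if $F_0=F_1$ it is undefined. $\mathrm{FaceTest}(Q_1,\dots,Q_K)$ goes through the pairs $i\ne j$, computes $R_{i,j}=\mathrm{Residue}(Q_i\,|\,Q_j)$ and returns $0$ as soon as $\kappa^*(Q_i\,|\,R_{i,j})=1$;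 if this never happens it returns $1$. $\mathrm{Demix}(S_1,\dots,S_K)$, $K\ge 2$, is the following recursive randomized algorithm. If $K=2$, return $(\mathrm{Residue}(S_1|S_2),\mathrm{Residue}(S_2|S_1))$. If $K>2$: draw $Q$ uniformly from the convex hull $\mathrm{co}(S_2,\dots,S_K)$, independently of all other draws (the barycentric coordinates of $Q$ with respect to $S_2,\dots,S_K$ are drawn uniformly from the standard simplex $\Delta_{K-1}$); for $n=2,3,\dots$ compute $R_i=\mathrm{Residue}(\tfrac1nS_i+\tfrac{n-1}nQ\,|\,S_1)$ for $i=2,\dots,K$, until $\mathrm{FaceTest}(R_2,\dots,R_K)=1$; let $(Q_1,\dots,Q_{K-1})=\mathrm{Demix}(R_2,\dots,R_K)$; start from $Q_K=\frac1K\sum_{i=1}^KS_i$ and, for $i=1,\dots,K-1$, replace $Q_K$ by $\mathrm{Residue}(Q_K\,|\,Q_i)$; return $(Q_1,\dots,Q_K)$. -/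

import Mathlib

open MeasureTheory ProbabilityTheory

namespace Demix

/-! Distributions are handled inside the real vector space `SignedMeasure X`, where their linear
combinations live. Steps of the algorithms that may be undefined or may fail to terminate take
values in `Part`. -/

/-- A probability distribution, seen as a signed measure. -/
noncomputable def signed {X : Type*} [MeasurableSpace X] (μ : ProbabilityMeasure X) :
    SignedMeasure X :=
  (μ : Measure X).toSignedMeasure

/-- The signed measure `F` is a probability distribution. -/
def IsDistribution {X : Type*} [MeasurableSpace X] (F : SignedMeasure X) : Prop :=
  ∃ μ : ProbabilityMeasure X, F = signed μ

/-- Joint irreducibility: a linear combination of the `P i` that is a distribution has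
nonnegative coefficients. -/
def JointlyIrreducible {X : Type*} [MeasurableSpace X] {L : ℕ}
    (P : Fin L → ProbabilityMeasure X) : Prop :=
  ∀ γ : Fin L → ℝ, IsDistribution (∑ i, γ i • signed (P i)) → ∀ i, 0 ≤ γ i

/-- The two-sample operator `κ*(F₀ | F₁)`: the largest proportion `κ` of `F₁` in `F₀`. -/
noncomputable def kappa {X : Type*} [MeasurableSpace X] (F₀ F₁ : SignedMeasure X) : ℝ :=
  sSup {κ : ℝ | 0 ≤ κ ∧ κ ≤ 1 ∧
    ∃ G : SignedMeasure X, IsDistribution G ∧ F₀ = (1 - κ) • G + κ • F₁}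

/-- The residue of `F₀` with respect to `F₁`, i.e. the `G` with `F₀ = (1 - κ) G + κ F₁` for
`κ = κ*(F₀ | F₁)`. It is undefined when `F₀ = F₁`. -/
noncomputable def residue {X : Type*} [MeasurableSpace X] (F₀ F₁ : SignedMeasure X) :
    Part (SignedMeasure X) :=
  ⟨F₀ ≠ F₁, fun _ => (1 - kappa F₀ F₁)⁻¹ • (F₀ - kappa F₀ F₁ • F₁)⟩

open Classical in
/-- The double loop of FaceTest, over a list of pairs `(i, j)` still to be visited. -/
noncomputable def faceTestLoop {X : Type*} [MeasurableSpace X] {k : ℕ}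
    (Q : Fin k → SignedMeasure X) : List (Fin k × Fin k) → Part Bool
  | [] => Part.some true
  | (i, j) :: l =>
    if i = j then faceTestLoop Q l
    else (residue (Q i) (Q j)).bind fun R =>
      if kappa (Q i) R = 1 then Part.some false else faceTestLoop Q l

/-- `FaceTest(Q₁, …, Q_k)`. -/
noncomputable def faceTest {X : Type*} [MeasurableSpace X] {k : ℕ}
    (Q : Fin k → SignedMeasure X) : Part Bool :=
  faceTestLoop Q (List.product (List.finRange k) (List.finRange k))

/-- Evaluate finitely many partial values; undefined as soon as one of them is. -/
def evalAll {α : Type*} {k : ℕ} (f : Fin k → Part α) : Part (Fin k → α) :=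
  ⟨∀ i, (f i).Dom, fun h i => (f i).get (h i)⟩

/-- The full-dimensional simplex `{x ∈ ℝᵏ : x ≥ 0, ∑ xᵢ ≤ 1}`. -/
def cornerSimplex (k : ℕ) : Set (Fin k → ℝ) :=
  {x | (∀ i, 0 ≤ x i) ∧ ∑ i, x i ≤ 1}

/-- The point of `co(v₀, …, v_k)` with barycentric coordinates `1 - ∑ xᵢ, x₁, …, x_k`. For affinely
independent `v₀, …, v_k` this is an affine bijection from `cornerSimplex k` onto
`co(v₀, …, v_k)`, hence carries the uniform distribution of the former to that of the latter. -/
def hullPoint {E : Type*} [AddCommGroup E] [Module ℝ E] {k : ℕ} (v : Fin (k + 1) → E)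
    (x : Fin k → ℝ) : E :=
  (1 - ∑ i, x i) • v 0 + ∑ i, x i • v i.succ

/-- The distributions `R₂, …, R_K` computed in the pass with counter `n` of the while loop:
the residues of `(1/n) Sᵢ + ((n-1)/n) Q` with respect to `S₁`. -/
noncomputable def candidates {X : Type*} [MeasurableSpace X] {k : ℕ}
    (S : Fin (k + 1) → SignedMeasure X) (Q : SignedMeasure X) (n : ℕ) :
    Part (Fin k → SignedMeasure X) :=
  evalAll fun i : Fin k =>
    residue ((1 / (n : ℝ)) • S i.succ + (((n : ℝ) - 1) / (n : ℝ)) • Q) (S 0)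

/-- The while loop: the counter `n = 2, 3, …` at which FaceTest first returns `1`. It is undefined if
there is no such `n`, or if an earlier pass is undefined. -/
noncomputable def stoppingIndex {X : Type*} [MeasurableSpace X] {k : ℕ}
    (S : Fin (k + 1) → SignedMeasure X) (Q : SignedMeasure X) : Part ℕ :=
  (Nat.rfind fun t : ℕ => (candidates S Q (t + 2)).bind fun R => faceTest R).map (· + 2)

/-- The final for loop: starting from `F`, take residues successively with respect to
`Q₁, …, Q_k`. -/
noncomputable def successiveResidues {X : Type*} [MeasurableSpace X] {k : ℕ}
    (F : SignedMeasure X) (Q : Fin k → SignedMeasure X) : Part (SignedMeasure X) :=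
  (List.ofFn Q).foldl (fun acc G => acc.bind fun H => residue H G) (Part.some F)

/-- `Demix(S₁, …, S_K)`, run on the random tape `u`: the call with `K ≥ 3` arguments draws its
point `Q` of `co(S₂, …, S_K)` from the tape entry `u (K - 2) ∈ ℝ^(K-2)`. The algorithm is
meant for `K ≥ 2` and is undefined for `K ≤ 1`. -/
noncomputable def demix {X : Type*} [MeasurableSpace X] (u : (k : ℕ) → Fin k → ℝ) :
    (K : ℕ) → (Fin K → SignedMeasure X) → Part (Fin K → SignedMeasure X)
  | 0, _ => Part.none
  | 1, _ => Part.none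
  | 2, S => evalAll ![residue (S 0) (S 1), residue (S 1) (S 0)]
  | m + 3, S =>
    let Q : SignedMeasure X := hullPoint (fun i : Fin (m + 2) => S i.succ) (u (m + 1))
    (stoppingIndex S Q).bind fun n =>
    (candidates S Q n).bind fun R =>
    (demix u (m + 2) R).bind fun T =>
    (successiveResidues ((1 / ((m + 3 : ℕ) : ℝ)) • ∑ i, S i) T).bind fun QK =>
    Part.some (Fin.snoc T QK)

end Demix

/-! Joint irreducibility makes `mix P` identify the standard simplex with the distributions in the
span of the `P i` (`isDistribution_mix_iff`, `mix_injective`), so the algorithm becomes geometry in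
a simplex. The residue of a with respect to b is the point where the ray from b through a leaves the
simplex, on a face x_l = 0 with l minimising a_l / b_l (`residue_mix`). FaceTest succeeds exactly
when all its points have the same support (`faceTest_mix`).

Hence, whenever the test succeeds, the candidates share a vanishing coordinate l. They stay linearly
independent, so the recursive call faces the same problem with one vertex fewer
(`exists_stoppingIndex`). It returns the other vertices, and stripping these from the mean of the
samples leaves vertex l (`successiveResidues_mix`).

The test does succeed eventually: the mixtures tend to Q, and if the residue of Q vanishes at a
single vertex of the current face, then for large n all candidates vanish there and nowhere else on
that face (`exists_faceTest_eq_true`). This can fail only if the coordinates of Q lie in one of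
finitely many hyperplanes. Q is independent of the draws that produced the current samples, so by
Fubini this has probability zero (`ae_isGeneric`). -/

namespace Demix

/-! ### Coordinates: distributions as points of the simplex. -/

variable {X : Type*} [MeasurableSpace X] {L : ℕ}

/-- The linear combination of the distributions `P i` with coefficients `a`. -/
noncomputable def mix (P : Fin L → ProbabilityMeasure X) :
    (Fin L → ℝ) →ₗ[ℝ] SignedMeasure X :=
  Fintype.linearCombination ℝ (fun i => signed (P i))

theorem mix_single (P : Fin L → ProbabilityMeasure X) (i : Fin L) :
    mix P (Pi.single i 1) = signed (P i) := by
  simp [mix]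

theorem mix_apply_set (P : Fin L → ProbabilityMeasure X) (a : Fin L → ℝ) {A : Set X}
    (hA : MeasurableSet A) : mix P a A = ∑ i, a i * (P i : Measure X).real A := by
  have h := congrFun (FunLike.coe_sum Finset.univ fun i => a i • signed (P i)) A
  rw [Finset.sum_apply] at h
  refine h.trans (Finset.sum_congr rfl fun i _ => ?_)
  change a i • (signed (P i)) A = _
  rw [signed, Measure.toSignedMeasure_apply_measurable hA, smul_eq_mul]

theorem IsDistribution.apply_univ {F : SignedMeasure X} (hF : IsDistribution F) :
    F Set.univ = 1 := by
  obtain ⟨μ, rfl⟩ := hF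
  simp [signed, Measure.toSignedMeasure_apply_measurable MeasurableSet.univ]

theorem isDistribution_mix (P : Fin L → ProbabilityMeasure X) {a : Fin L → ℝ}
    (ha : a ∈ stdSimplex ℝ (Fin L)) : IsDistribution (mix P a) := by
  have h0 : 0 ≤[Set.univ] mix P a := by
    refine VectorMeasure.restrict_le_restrict_of_subset_le _ _ fun A hA _ => ?_
    rw [mix_apply_set P a hA]
    exact Finset.sum_nonneg fun i _ => mul_nonneg (ha.1 i) measureReal_nonneg
  have h1 : mix P a Set.univ = 1 := by
    rw [mix_apply_set P a MeasurableSet.univ]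
    simpa using ha.2
  set ν := (mix P a).toMeasureOfZeroLE Set.univ MeasurableSet.univ h0 with hν
  have h2 : ν.toSignedMeasure = mix P a := by
    exact SignedMeasure.toMeasureOfZeroLE_toSignedMeasure _ h0
  have h3 : ν.real Set.univ = 1 := by
    rw [← Measure.toSignedMeasure_apply_measurable MeasurableSet.univ, h2, h1]
  have h4 : IsProbabilityMeasure ν := by
    constructor
    rw [measureReal_def] at h3
    exact (ENNReal.toReal_eq_one_iff _).1 h3
  exact ⟨⟨ν, h4⟩, h2.symm⟩

namespace JointlyIrreducible

variable {P : Fin L → ProbabilityMeasure X}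

theorem isDistribution_mix_iff (hP : JointlyIrreducible P) {a : Fin L → ℝ} :
    IsDistribution (mix P a) ↔ a ∈ stdSimplex ℝ (Fin L) := by
  refine ⟨fun h => ⟨hP a h, ?_⟩, isDistribution_mix P⟩
  have := h.apply_univ
  rw [mix_apply_set P a MeasurableSet.univ] at this
  simpa using this

theorem mix_injective (hP : JointlyIrreducible P) : Function.Injective (mix P) := by
  rw [injective_iff_map_eq_zero]
  intro a ha
  by_contra hne
  obtain ⟨i, hi⟩ := Function.ne_iff.1 hne
  have hi : a i ≠ 0 := hi
  -- Moving from vertex i along the kernel vector `a` keeps the distribution `P i`; the factor makes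
  -- coordinate i equal to 1 - 2 = -1.
  have h : Pi.single i 1 + (-2 / a i) • a ∈ stdSimplex ℝ (Fin L) := by
    rw [← hP.isDistribution_mix_iff, map_add, map_smul, ha, smul_zero, add_zero]
    exact isDistribution_mix P (single_mem_stdSimplex ℝ i)
  have := h.1 i
  simp [hi] at this

end JointlyIrreducible

/-! ### Rays and minimal ratios in the simplex. -/

/-- The point where the ray from `b` through `a` meets the hyperplane of points whose
`l`-th coordinate vanishes. -/
noncomputable def ray {ι : Type*} (a b : ι → ℝ) (l : ι) : ι → ℝ :=
  (b l - a l)⁻¹ • (b l • a - a l • b)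

theorem ray_self {ι : Type*} (a b : ι → ℝ) (l : ι) : ray a b l l = 0 := by
  simp [ray, mul_comm]

theorem ray_apply {ι : Type*} (a b : ι → ℝ) (l j : ι) :
    ray a b l j = (b l - a l)⁻¹ * (b l * a j - a l * b j) := rfl

/-- `l` minimises the ratio `a l / b l`. -/
def IsMinRatio {ι : Type*} (a b : ι → ℝ) (l : ι) : Prop :=
  0 < b l ∧ ∀ j, a l * b j ≤ b l * a j

theorem exists_isMinRatio {a b : Fin L → ℝ} (ha : a ∈ stdSimplex ℝ (Fin L))
    (hb : b ∈ stdSimplex ℝ (Fin L)) : ∃ l, IsMinRatio a b l := by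
  have hne : (Finset.univ.filter fun j => 0 < b j).Nonempty := by
    by_contra h
    rw [Finset.not_nonempty_iff_eq_empty, Finset.filter_eq_empty_iff] at h
    have : ∑ j, b j ≤ 0 := Finset.sum_nonpos fun j hj => not_lt.1 (h hj)
    linarith [hb.2]
  obtain ⟨l, hl, hmin⟩ := Finset.exists_min_image _ (fun j => a j / b j) hne
  simp only [Finset.mem_filter, Finset.mem_univ, true_and] at hl hmin
  refine ⟨l, hl, fun j => ?_⟩
  rcases (hb.1 j).lt_or_eq with hj | hj
  · have := (div_le_div_iff₀ hl hj).1 (hmin j hj)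
    linarith
  · rw [← hj, mul_zero]
    exact mul_nonneg hl.le (ha.1 j)

/-- Otherwise every ratio is at least 1, so `a` dominates `b` coordinatewise, and equal sums force
`a = b`. -/
theorem IsMinRatio.lt {a b : Fin L → ℝ} (ha : a ∈ stdSimplex ℝ (Fin L))
    (hb : b ∈ stdSimplex ℝ (Fin L)) (hab : a ≠ b) {l : Fin L} (h : IsMinRatio a b l) :
    a l < b l := by
  by_contra! hle
  refine hab (funext fun j => ?_)
  have key : ∀ j ∈ Finset.univ, b j ≤ a j := fun j _ => by
    have h1 := h.2 j
    have h2 := mul_le_mul_of_nonneg_right hle (hb.1 j)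
    exact le_of_mul_le_mul_left (h2.trans h1) h.1
  exact ((Finset.sum_eq_sum_iff_of_le key).1 (hb.2.trans ha.2.symm) j (Finset.mem_univ j)).symm

theorem ray_mem_stdSimplex {a b : Fin L → ℝ} (ha : a ∈ stdSimplex ℝ (Fin L))
    (hb : b ∈ stdSimplex ℝ (Fin L)) (hab : a ≠ b) {l : Fin L} (h : IsMinRatio a b l) :
    ray a b l ∈ stdSimplex ℝ (Fin L) := by
  have hlt := h.lt ha hb hab
  refine ⟨fun j => ?_, ?_⟩
  · rw [ray_apply]
    exact mul_nonneg (inv_nonneg.2 (sub_pos.2 hlt).le) (sub_nonneg.2 (h.2 j))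
  · simp only [ray_apply]
    rw [← Finset.mul_sum, Finset.sum_sub_distrib, ← Finset.mul_sum, ← Finset.mul_sum, ha.2, hb.2,
      mul_one, mul_one, inv_mul_cancel₀ (sub_pos.2 hlt).ne']

/-! ### The operators κ*, Residue and FaceTest in coordinates. -/

section Residue

variable {P : Fin L → ProbabilityMeasure X} (hP : JointlyIrreducible P)
include hP

/-- The ray point realises this proportion. Conversely, for any admissible κ the remainder `G` is
itself a mixture of the `P i`, and nonnegativity of its coordinate `l` bounds κ. -/
theorem kappa_mix {a b : Fin L → ℝ} (ha : a ∈ stdSimplex ℝ (Fin L))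
    (hb : b ∈ stdSimplex ℝ (Fin L)) (hab : a ≠ b) {l : Fin L} (h : IsMinRatio a b l) :
    kappa (mix P a) (mix P b) = a l / b l := by
  have hlt := h.lt ha hb hab
  have hb0 := h.1
  have h1 : a l / b l < 1 := (div_lt_one hb0).2 hlt
  refine IsGreatest.csSup_eq ⟨⟨div_nonneg (ha.1 l) hb0.le, h1.le, mix P (ray a b l),
    isDistribution_mix P (ray_mem_stdSimplex ha hb hab h), ?_⟩, ?_⟩
  · rw [← map_smul, ← map_smul, ← map_add]
    congr 1
    ext j
    have h2 : b l - a l ≠ 0 := (sub_pos.2 hlt).ne'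
    simp only [Pi.add_apply, Pi.smul_apply, smul_eq_mul, ray_apply]
    field_simp
    ring
  · rintro κ ⟨hκ0, hκ1, G, hG, hE⟩
    have hne : 1 - κ ≠ 0 := by
      intro h0
      have : κ = 1 := by linarith
      subst this
      simp only [sub_self, zero_smul, one_smul, zero_add] at hE
      exact hab (hP.mix_injective hE)
    have hGm : G = mix P ((1 - κ)⁻¹ • (a - κ • b)) := by
      rw [map_smul, map_sub, map_smul, hE, add_sub_cancel_right, smul_smul, inv_mul_cancel₀ hne,
        one_smul]
    rw [hGm, hP.isDistribution_mix_iff] at hG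
    have h3 := hG.1 l
    have h4 : 0 < (1 - κ)⁻¹ := inv_pos.2 (lt_of_le_of_ne (by linarith) hne.symm)
    have h5 : 0 ≤ a l - κ * b l := nonneg_of_mul_nonneg_right (by simpa using h3) h4
    rw [le_div_iff₀ hb0]
    linarith

theorem residue_mix {a b : Fin L → ℝ} (ha : a ∈ stdSimplex ℝ (Fin L))
    (hb : b ∈ stdSimplex ℝ (Fin L)) (hab : a ≠ b) {l : Fin L} (h : IsMinRatio a b l) :
    residue (mix P a) (mix P b) = Part.some (mix P (ray a b l)) := by
  refine Part.eq_some_iff.2 ⟨fun e => hab (hP.mix_injective e), ?_⟩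
  change (1 - kappa (mix P a) (mix P b))⁻¹ • (mix P a - kappa (mix P a) (mix P b) • mix P b) = _
  rw [kappa_mix hP ha hb hab h, ← map_smul, ← map_sub, ← map_smul]
  congr 1
  ext j
  have hlt := h.lt ha hb hab
  have hb0 := h.1.ne'
  have h2 : b l - a l ≠ 0 := (sub_pos.2 hlt).ne'
  have h3 : 1 - a l / b l ≠ 0 := by
    rw [one_sub_div hb0]; exact div_ne_zero h2 hb0
  simp only [Pi.sub_apply, Pi.smul_apply, smul_eq_mul, ray_apply]
  rw [one_sub_div hb0]
  field_simp

theorem kappa_mix_eq_one_iff {a b : Fin L → ℝ} (ha : a ∈ stdSimplex ℝ (Fin L))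
    (hb : b ∈ stdSimplex ℝ (Fin L)) : kappa (mix P a) (mix P b) = 1 ↔ a = b := by
  refine ⟨fun h => ?_, ?_⟩
  · by_contra hab
    obtain ⟨l, hl⟩ := exists_isMinRatio ha hb
    rw [kappa_mix hP ha hb hab hl, div_eq_one_iff_eq hl.1.ne'] at h
    exact (hl.lt ha hb hab).ne h
  · rintro rfl
    exact IsGreatest.csSup_eq ⟨⟨zero_le_one, le_rfl, mix P a, isDistribution_mix P ha, by simp⟩,
      fun κ hκ => hκ.2.1⟩

/-- For `R` the residue of `mix P a` with respect to `mix P b`, the support of `b` is contained in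
the support of `a` if and only if `κ*(mix P a | R) ≠ 1`. -/
theorem exists_residue_mix {a b : Fin L → ℝ} (ha : a ∈ stdSimplex ℝ (Fin L))
    (hb : b ∈ stdSimplex ℝ (Fin L)) (hab : a ≠ b) :
    ∃ R, residue (mix P a) (mix P b) = Part.some R ∧
      (kappa (mix P a) R ≠ 1 ↔ ∀ j, b j ≠ 0 → a j ≠ 0) := by
  obtain ⟨l, hl⟩ := exists_isMinRatio ha hb
  refine ⟨_, residue_mix hP ha hb hab hl, ?_⟩
  rw [Ne, kappa_mix_eq_one_iff hP ha (ray_mem_stdSimplex ha hb hab hl)]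
  have hlt := hl.lt ha hb hab
  constructor
  -- If a_j = 0 < b_j, the minimal ratio is 0, nothing is subtracted, and the residue is `a` itself.
  · intro h j hj hj0
    have h1 := hl.2 j
    rw [hj0, mul_zero] at h1
    have h2 : 0 < b j := lt_of_le_of_ne (hb.1 j) (Ne.symm hj)
    have h3 : a l = 0 := le_antisymm (nonpos_of_mul_nonpos_left h1 h2) (ha.1 l)
    apply h
    ext i
    rw [ray_apply, h3]
    have := hl.1.ne'
    field_simp
    ring
  · intro h e
    apply h l hl.1.ne'
    rw [e, ray_self]

theorem faceTestLoop_mix {k : ℕ} {q : Fin k → Fin L → ℝ}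
    (hq : ∀ i, q i ∈ stdSimplex ℝ (Fin L)) (hinj : Function.Injective q)
    (l : List (Fin k × Fin k)) :
    ∃ t : Bool, faceTestLoop (fun i => mix P (q i)) l = Part.some t ∧
      (t = true ↔ ∀ p ∈ l, ∀ j, q p.2 j ≠ 0 → q p.1 j ≠ 0) := by
  induction l with
  | nil => exact ⟨true, rfl, by simp⟩
  | cons p l ih =>
    obtain ⟨i, j⟩ := p
    obtain ⟨t, ht, htiff⟩ := ih
    by_cases hij : i = j
    · refine ⟨t, by rw [faceTestLoop, if_pos hij, ht], ?_⟩
      rw [htiff]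
      subst hij
      simp
    · obtain ⟨R, hR, hRiff⟩ := exists_residue_mix hP (hq i) (hq j) (hinj.ne hij)
      by_cases hk : kappa (mix P (q i)) R = 1
      · refine ⟨false, by rw [faceTestLoop, if_neg hij, hR, Part.bind_some, if_pos hk], ?_⟩
        refine iff_of_false (by simp) fun h => ?_
        exact hRiff.2 (h (i, j) (by simp)) hk
      · refine ⟨t, by rw [faceTestLoop, if_neg hij, hR, Part.bind_some, if_neg hk, ht], ?_⟩
        rw [htiff, List.forall_mem_cons]
        exact (and_iff_right (hRiff.1 hk)).symm

/-- The loop visits both orders of each pair, so the inclusions of supports become equalities. -/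
theorem faceTest_mix {k : ℕ} {q : Fin k → Fin L → ℝ}
    (hq : ∀ i, q i ∈ stdSimplex ℝ (Fin L)) (hinj : Function.Injective q) :
    ∃ t : Bool, faceTest (fun i => mix P (q i)) = Part.some t ∧
      (t = true ↔ ∀ i i' j, q i j = 0 → q i' j = 0) := by
  obtain ⟨t, ht, hiff⟩ := faceTestLoop_mix hP hq hinj (List.product (List.finRange k)
    (List.finRange k))
  refine ⟨t, ht, hiff.trans ⟨fun h i i' j hi => ?_, fun h p _ j hj hj' => hj (h _ _ _ hj')⟩⟩
  by_contra h'
  exact h (i, i') (List.pair_mem_product.2 ⟨List.mem_finRange _, List.mem_finRange _⟩) j h' hi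

/-- A residue with respect to vertex j kills coordinate j and rescales the others by 1 / (1 - a_j).
Coordinate `l` thus survives throughout, which also keeps each intermediate point different from the
next vertex and each residue defined. -/
theorem foldl_residue_mix (l : Fin L) (js : List (Fin L)) (hl : l ∉ js) {a : Fin L → ℝ}
    (ha : a ∈ stdSimplex ℝ (Fin L)) (hal : a l ≠ 0) :
    ∃ c ∈ stdSimplex ℝ (Fin L), (∀ j, a j = 0 → c j = 0) ∧ (∀ j ∈ js, c j = 0) ∧
      (js.map fun j => signed (P j)).foldl (fun acc G => acc.bind fun H => residue H G)
        (Part.some (mix P a)) = Part.some (mix P c) := by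
  induction js generalizing a with
  | nil => exact ⟨a, ha, fun _ h => h, by simp, rfl⟩
  | cons j js ih =>
    rw [List.mem_cons, not_or] at hl
    have hs := single_mem_stdSimplex ℝ j
    have hne : a ≠ Pi.single j 1 := by
      rintro rfl
      exact hal (by simp [hl.1])
    have hmin : IsMinRatio a (Pi.single j 1) j := by
      refine ⟨by simp, fun i => ?_⟩
      by_cases hij : i = j
      · subst hij; simp
      · simpa [hij] using ha.1 i
    have hlt := hmin.lt ha hs hne
    have hray : ∀ i, i ≠ j → ray a (Pi.single j 1) j i = (1 - a j)⁻¹ * a i := by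
      intro i hi
      simp [ray_apply, hi]
    have hlt' : 0 < 1 - a j := by simpa using hlt
    obtain ⟨c, hc, hc1, hc2, hc3⟩ := ih hl.2 (ray_mem_stdSimplex ha hs hne hmin)
      (by rw [hray l hl.1]; exact mul_ne_zero (inv_ne_zero hlt'.ne') hal)
    refine ⟨c, hc, fun i hi => hc1 i ?_, ?_, ?_⟩
    · by_cases hij : i = j
      · subst hij; exact ray_self _ _ _
      · rw [hray i hij, hi, mul_zero]
    · intro i hi
      rcases List.mem_cons.1 hi with rfl | hi
      · exact hc1 _ (ray_self _ _ _)
      · exact hc2 i hi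
    · rw [List.map_cons, List.foldl_cons, Part.bind_some, ← mix_single,
        residue_mix hP ha hs hne hmin, hc3]

end Residue

theorem eq_single_of_mem_stdSimplex {a : Fin L → ℝ} (ha : a ∈ stdSimplex ℝ (Fin L)) {l : Fin L}
    (h : ∀ j, j ≠ l → a j = 0) : a = Pi.single l 1 := by
  have h1 : a l = 1 := by
    rw [← ha.2]
    exact (Finset.sum_eq_single l (fun j _ hj => h j hj) (by simp)).symm
  ext j
  by_cases hj : j = l
  · subst hj; simp [h1]
  · simp [hj, h j hj]

theorem successiveResidues_mix {P : Fin L → ProbabilityMeasure X} (hP : JointlyIrreducible P)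
    {k : ℕ} (σ : Fin k → Fin L) (l : Fin L)
    (hl : ∀ i, σ i ≠ l) {a : Fin L → ℝ} (ha : a ∈ stdSimplex ℝ (Fin L)) (hal : a l ≠ 0)
    (hsupp : ∀ j, j ≠ l → (∀ i, σ i ≠ j) → a j = 0) :
    successiveResidues (mix P a) (fun i => signed (P (σ i))) = Part.some (signed (P l)) := by
  obtain ⟨c, hc, hc1, hc2, hc3⟩ := foldl_residue_mix hP l (List.ofFn σ)
    (by simpa [List.mem_ofFn] using hl) ha hal
  rw [List.map_ofFn] at hc3
  rw [successiveResidues]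
  refine hc3.trans ?_
  rw [eq_single_of_mem_stdSimplex hc (l := l), mix_single]
  intro j hj
  by_cases h : ∃ i, σ i = j
  · obtain ⟨i, rfl⟩ := h
    exact hc2 _ (List.mem_ofFn.2 ⟨i, rfl⟩)
  · exact hc1 j (hsupp j hj (by simpa using h))

theorem evalAll_some {α : Type*} {k : ℕ} {f : Fin k → Part α} {g : Fin k → α}
    (h : ∀ i, f i = Part.some (g i)) : evalAll f = Part.some g := by
  obtain rfl : f = fun i => Part.some (g i) := funext h
  exact Part.eq_some_iff.2 ⟨fun _ => trivial, rfl⟩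

/-! ### Linear independence of mixtures and residues. -/

/-- The points `s i` of the simplex are linearly independent and supported in `J`. -/
structure IsAdmissible (J : Finset (Fin L)) {k : ℕ} (s : Fin k → Fin L → ℝ) : Prop where
  mem : ∀ i, s i ∈ stdSimplex ℝ (Fin L)
  eq_zero : ∀ i, ∀ j ∉ J, s i j = 0
  li : LinearIndependent ℝ s

/-- A relation `g` gives a relation among the `s i` whose coefficients at `j.succ` are g_j α_j c + D
d w_j, with D = ∑ g_i α_i. Summing these zeros over j yields D (c + d) = D = 0, and then each g_j
vanishes. -/
theorem linearIndependent_shear {E : Type*} [AddCommGroup E] [Module ℝ E] {k : ℕ}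
    {s : Fin (k + 1) → E} (hs : LinearIndependent ℝ s) {c d : ℝ} (hc : c ≠ 0) (hcd : c + d = 1)
    {w : Fin k → ℝ} (hw : ∑ i, w i = 1) {α : Fin k → ℝ} (hα : ∀ i, α i ≠ 0) (β : Fin k → ℝ) :
    LinearIndependent ℝ
      (fun i => α i • (c • s i.succ + d • ∑ j, w j • s j.succ) + β i • s 0) := by
  rw [Fintype.linearIndependent_iff]
  intro g hg
  set D := ∑ i, g i * α i with hD
  have h0 : ∑ i, (Fin.cons (∑ i, g i * β i) (fun j => g j * α j * c + D * d * w j) :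
      Fin (k + 1) → ℝ) i • s i = 0 := by
    rw [Fin.sum_univ_succ]
    simp only [Fin.cons_zero, Fin.cons_succ]
    rw [← hg]
    simp only [smul_add, add_smul, Finset.sum_add_distrib, smul_smul, Finset.smul_sum,
      Finset.sum_smul]
    rw [add_comm]
    congr 2
    · exact Finset.sum_congr rfl fun j _ => by rw [mul_assoc]
    rw [Finset.sum_comm]
    refine Finset.sum_congr rfl fun j _ => ?_
    rw [← Finset.sum_smul, hD, Finset.sum_mul, Finset.sum_mul]
    congr 1
    exact Finset.sum_congr rfl fun i _ => by ring
  have h1 := Fintype.linearIndependent_iff.1 hs _ h0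
  have h2 : ∀ j, g j * α j * c + D * d * w j = 0 := fun j => by simpa using h1 j.succ
  have h3 : D = 0 := by
    have : ∑ j, (g j * α j * c + D * d * w j) = 0 := Finset.sum_eq_zero fun j _ => h2 j
    rw [Finset.sum_add_distrib, ← Finset.sum_mul, ← Finset.mul_sum, hw, ← hD] at this
    linear_combination this - D * hcd
  intro i
  have := h2 i
  rw [h3] at this
  simpa [hα i, hc] using this

/-- The barycentric coordinates of the point of the simplex with coordinates `x`. -/
def weights {k : ℕ} (x : Fin k → ℝ) : Fin (k + 1) → ℝ := Fin.cons (1 - ∑ i, x i) x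

theorem hullPoint_eq_sum {E : Type*} [AddCommGroup E] [Module ℝ E] {k : ℕ} (v : Fin (k + 1) → E)
    (x : Fin k → ℝ) : hullPoint v x = ∑ i, weights x i • v i := by
  rw [Fin.sum_univ_succ]
  simp [hullPoint, weights]

theorem weights_mem_stdSimplex {k : ℕ} {x : Fin k → ℝ} (hx : x ∈ cornerSimplex k) :
    weights x ∈ stdSimplex ℝ (Fin (k + 1)) := by
  refine ⟨fun i => ?_, ?_⟩
  · refine Fin.cases ?_ (fun i => ?_) i
    · simpa [weights] using hx.2
    · simpa [weights] using hx.1 i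
  · rw [Fin.sum_univ_succ]
    simp [weights]

theorem map_hullPoint {E F : Type*} [AddCommGroup E] [Module ℝ E] [AddCommGroup F] [Module ℝ F]
    (f : E →ₗ[ℝ] F) {k : ℕ} (v : Fin (k + 1) → E) (x : Fin k → ℝ) :
    f (hullPoint v x) = hullPoint (fun i => f (v i)) x := by
  simp [hullPoint_eq_sum]

theorem hullPoint_mem {E : Type*} [AddCommGroup E] [Module ℝ E] {C : Set E} (hC : Convex ℝ C)
    {k : ℕ} {v : Fin (k + 1) → E} (hv : ∀ i, v i ∈ C) {x : Fin k → ℝ}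
    (hx : x ∈ cornerSimplex k) : hullPoint v x ∈ C := by
  rw [hullPoint_eq_sum]
  have hw := weights_mem_stdSimplex hx
  exact hC.sum_mem (fun i _ => hw.1 i) hw.2 fun i _ => hv i

/-- The point `(1/n) S_i + ((n-1)/n) Q`. -/
noncomputable def mixture {E : Type*} [AddCommGroup E] [Module ℝ E] {k : ℕ}
    (s : Fin (k + 1) → E) (q : E) (n : ℕ) (i : Fin k) : E :=
  (1 / (n : ℝ)) • s i.succ + (((n : ℝ) - 1) / (n : ℝ)) • q

/-- The candidates of the pass `n`, in coordinates, when all minimal ratios are attained at `l`. -/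
noncomputable def nextSamples {k : ℕ} (s : Fin (k + 2) → Fin L → ℝ) (x : Fin k → ℝ) (n : ℕ)
    (l : Fin L) : Fin (k + 1) → Fin L → ℝ :=
  fun i => ray (mixture s (hullPoint (fun i => s i.succ) x) n i) (s 0) l

theorem mixture_mem {k : ℕ} {s : Fin (k + 2) → Fin L → ℝ}
    (hs : ∀ i, s i ∈ stdSimplex ℝ (Fin L)) {x : Fin k → ℝ} (hx : x ∈ cornerSimplex k)
    {n : ℕ} (hn : 0 < n) (i : Fin (k + 1)) :
    mixture s (hullPoint (fun i => s i.succ) x) n i ∈ stdSimplex ℝ (Fin L) := by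
  have hn' : (0 : ℝ) < n := by exact_mod_cast hn
  have hn1 : (1 : ℝ) ≤ n := by exact_mod_cast hn
  refine convex_stdSimplex ℝ (Fin L) (hs _) (hullPoint_mem (convex_stdSimplex ℝ _)
    (fun i => hs i.succ) hx) (by positivity) (div_nonneg (by linarith) hn'.le) ?_
  field_simp
  ring

theorem linearIndependent_mixture {k : ℕ} {s : Fin (k + 2) → Fin L → ℝ}
    (hs : LinearIndependent ℝ s) (x : Fin k → ℝ) {n : ℕ} (hn : 0 < n)
    {α : Fin (k + 1) → ℝ} (hα : ∀ i, α i ≠ 0) (β : Fin (k + 1) → ℝ) :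
    LinearIndependent ℝ
      (fun i => α i • mixture s (hullPoint (fun i => s i.succ) x) n i + β i • s 0) := by
  have hn' : (n : ℝ) ≠ 0 := by exact_mod_cast hn.ne'
  have hw : ∑ i, weights x i = 1 := by
    rw [Fin.sum_univ_succ]
    simp [weights]
  have := linearIndependent_shear hs (c := 1 / (n : ℝ)) (d := ((n : ℝ) - 1) / n) (one_div_ne_zero hn')
    (by field_simp; ring) hw hα β
  simpa only [mixture, hullPoint_eq_sum] using this

/-- The index `l` may vary with `i`: FaceTest needs distinct candidates before a common face is
known. -/
theorem linearIndependent_ray {k : ℕ} {s : Fin (k + 2) → Fin L → ℝ}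
    (hs : LinearIndependent ℝ s) (x : Fin k → ℝ) {n : ℕ} (hn : 0 < n) {l : Fin (k + 1) → Fin L}
    (h0 : ∀ i, s 0 (l i) ≠ 0)
    (h1 : ∀ i, mixture s (hullPoint (fun i => s i.succ) x) n i (l i) ≠ s 0 (l i)) :
    LinearIndependent ℝ
      (fun i => ray (mixture s (hullPoint (fun i => s i.succ) x) n i) (s 0) (l i)) := by
  have := linearIndependent_mixture hs x hn
    (α := fun i => (s 0 (l i) - mixture s (hullPoint (fun i => s i.succ) x) n i (l i))⁻¹ *
      s 0 (l i))
    (fun i => mul_ne_zero (inv_ne_zero (sub_ne_zero.2 (h1 i).symm)) (h0 i))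
    (fun i => -((s 0 (l i) - mixture s (hullPoint (fun i => s i.succ) x) n i (l i))⁻¹ *
      mixture s (hullPoint (fun i => s i.succ) x) n i (l i)))
  convert this using 2 with i
  rw [ray, smul_sub, smul_smul, smul_smul, neg_smul, sub_eq_add_neg]

theorem mixture_ne {k : ℕ} {s : Fin (k + 2) → Fin L → ℝ}
    (hs : LinearIndependent ℝ s) (x : Fin k → ℝ) {n : ℕ} (hn : 0 < n) (i : Fin (k + 1)) :
    mixture s (hullPoint (fun i => s i.succ) x) n i ≠ s 0 := by
  intro h
  have := (linearIndependent_mixture hs x hn (α := 1) (by simp) (fun _ => -1)).ne_zero i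
  simp [h] at this

/-! ### One level of the recursion for a generic Q. -/

/-- The residue of the point `Q` with respect to `S₁` has at most one vanishing coordinate
in `J`. -/
def IsGeneric (J : Finset (Fin L)) (a q : Fin L → ℝ) : Prop :=
  ∀ l ∈ J, ∀ j ∈ J, l ≠ j → a l ≠ 0 → a l * q j - q l * a j ≠ 0

theorem tendsto_mixture {k : ℕ} (s : Fin (k + 1) → Fin L → ℝ) (q : Fin L → ℝ) (i : Fin k)
    (j : Fin L) : Filter.Tendsto (fun n : ℕ => mixture s q n i j) Filter.atTop (nhds (q j)) := by
  have h1 : Filter.Tendsto (fun n : ℕ => 1 / (n : ℝ)) Filter.atTop (nhds 0) :=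
    tendsto_one_div_atTop_nhds_zero_nat
  have h2 : Filter.Tendsto (fun n : ℕ => 1 / (n : ℝ) * s i.succ j + (1 - 1 / (n : ℝ)) * q j)
      Filter.atTop (nhds (0 * s i.succ j + (1 - 0) * q j)) :=
    (h1.mul_const _).add ((h1.const_sub 1).mul_const _)
  rw [zero_mul, zero_add, sub_zero, one_mul] at h2
  refine h2.congr' ?_
  filter_upwards [Filter.eventually_gt_atTop 0] with n hn
  have hn' : (n : ℝ) ≠ 0 := by exact_mod_cast hn.ne'
  simp only [mixture, Pi.add_apply, Pi.smul_apply, smul_eq_mul]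
  rw [sub_div, div_self hn']

section Step

variable {P : Fin L → ProbabilityMeasure X} (hP : JointlyIrreducible P)
include hP

theorem candidates_mix {J : Finset (Fin L)} {k : ℕ} {s : Fin (k + 2) → Fin L → ℝ}
    (hs : IsAdmissible J s) {x : Fin k → ℝ} (hx : x ∈ cornerSimplex k) {n : ℕ} (hn : 0 < n)
    {l : Fin (k + 1) → Fin L}
    (hl : ∀ i, IsMinRatio (mixture s (hullPoint (fun i => s i.succ) x) n i) (s 0) (l i)) :
    candidates (fun i => mix P (s i)) (hullPoint (fun i => mix P (s i.succ)) x) n =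
      Part.some (fun i => mix P
        (ray (mixture s (hullPoint (fun i => s i.succ) x) n i) (s 0) (l i))) := by
  refine evalAll_some fun i => ?_
  rw [← residue_mix hP (mixture_mem hs.mem hx hn i) (hs.mem 0) (mixture_ne hs.li x hn i) (hl i),
    mixture, map_add, map_smul, map_smul, map_hullPoint]

theorem faceTest_candidates {J : Finset (Fin L)} {k : ℕ} {s : Fin (k + 2) → Fin L → ℝ}
    (hs : IsAdmissible J s) {x : Fin k → ℝ} (hx : x ∈ cornerSimplex k) {n : ℕ} (hn : 0 < n)
    {l : Fin (k + 1) → Fin L}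
    (hl : ∀ i, IsMinRatio (mixture s (hullPoint (fun i => s i.succ) x) n i) (s 0) (l i)) :
    ∃ t : Bool, ((candidates (fun i => mix P (s i)) (hullPoint (fun i => mix P (s i.succ)) x)
        n).bind fun R => faceTest R) = Part.some t ∧
      (t = true ↔ ∀ i i' j,
        ray (mixture s (hullPoint (fun i => s i.succ) x) n i) (s 0) (l i) j = 0 →
        ray (mixture s (hullPoint (fun i => s i.succ) x) n i') (s 0) (l i') j = 0) := by
  have hmem := fun i => ray_mem_stdSimplex (mixture_mem hs.mem hx hn i) (hs.mem 0)
    (mixture_ne hs.li x hn i) (hl i)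
  have hli := linearIndependent_ray hs.li x hn (fun i => (hl i).1.ne') fun i =>
    ((hl i).lt (mixture_mem hs.mem hx hn i) (hs.mem 0) (mixture_ne hs.li x hn i)).ne
  obtain ⟨t, ht, hiff⟩ := faceTest_mix hP hmem hli.injective
  exact ⟨t, by rw [candidates_mix hP hs hx hn hl, Part.bind_some, ht], hiff⟩

theorem exists_faceTest_eq_true {J : Finset (Fin L)} {k : ℕ} {s : Fin (k + 2) → Fin L → ℝ}
    (hs : IsAdmissible J s) {x : Fin k → ℝ} (hx : x ∈ cornerSimplex k)
    (hgen : IsGeneric J (s 0) (hullPoint (fun i => s i.succ) x)) :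
    ∃ t : ℕ, ((candidates (fun i => mix P (s i)) (hullPoint (fun i => mix P (s i.succ)) x)
        (t + 2)).bind fun R => faceTest R) = Part.some true := by
  set q := hullPoint (fun i => s i.succ) x with hq
  have hqm : q ∈ stdSimplex ℝ (Fin L) :=
    hullPoint_mem (convex_stdSimplex ℝ _) (fun i => hs.mem i.succ) hx
  have hq0 : ∀ j ∉ J, q j = 0 := fun j hj => by
    simp [hq, hullPoint_eq_sum, hs.eq_zero _ j hj]
  obtain ⟨l, hl⟩ := exists_isMinRatio hqm (hs.mem 0)
  have hlJ : l ∈ J := by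
    by_contra h
    exact hl.1.ne' (hs.eq_zero 0 l h)
  have hpos : ∀ j ∈ J, j ≠ l → 0 < s 0 l * q j - q l * s 0 j := fun j hj hjl =>
    lt_of_le_of_ne (sub_nonneg.2 (hl.2 j)) (hgen l hlJ j hj hjl.symm hl.1.ne').symm
  -- The strict inequalities at the limit `q` are open conditions, finitely many in number, so they
  -- pass to the mixtures for large n.
  have hev : ∀ᶠ n : ℕ in Filter.atTop, ∀ i : Fin (k + 1), ∀ j, j ∈ J → j ≠ l →
      0 < s 0 l * mixture s q n i j - mixture s q n i l * s 0 j := by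
    rw [Filter.eventually_all]
    intro i
    rw [Filter.eventually_all]
    intro j
    by_cases hj : j ∈ J ∧ j ≠ l
    · have := ((tendsto_mixture s q i j).const_mul (s 0 l)).sub
        ((tendsto_mixture s q i l).mul_const (s 0 j))
      filter_upwards [this.eventually (lt_mem_nhds (hpos j hj.1 hj.2))] with n hn _ _ using hn
    · exact Filter.Eventually.of_forall fun n h1 h2 => absurd ⟨h1, h2⟩ hj
  obtain ⟨n, hn, hn2⟩ := (hev.and (Filter.eventually_ge_atTop 2)).exists
  obtain ⟨t, rfl⟩ := Nat.exists_eq_add_of_le' hn2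
  have hM0 : ∀ i, ∀ j ∉ J, mixture s q (t + 2) i j = 0 := fun i j hj => by
    simp [mixture, hq0 j hj, hs.eq_zero _ j hj]
  have hmin : ∀ i, IsMinRatio (mixture s q (t + 2) i) (s 0) l := fun i => by
    refine ⟨hl.1, fun j => ?_⟩
    by_cases hj : j ∈ J
    · by_cases hjl : j = l
      · rw [hjl, mul_comm]
      · exact (sub_pos.1 (hn i j hj hjl)).le
    · rw [hM0 i j hj, hs.eq_zero 0 j hj, mul_zero, mul_zero]
  obtain ⟨b, hb, hiff⟩ := faceTest_candidates hP hs hx (Nat.succ_pos (t + 1)) (l := fun _ => l) hmin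
  refine ⟨t, ?_⟩
  rw [hb, hiff.2 ?_]
  intro i i' j h
  by_cases hjl : j = l
  · rw [hjl, ray_self]
  · by_cases hj : j ∈ J
    · refine absurd h ?_
      rw [ray_apply]
      exact mul_ne_zero (inv_ne_zero (sub_pos.2 ((hmin i).lt (mixture_mem hs.mem hx
        (Nat.succ_pos _) i) (hs.mem 0) (mixture_ne hs.li x (Nat.succ_pos _) i))).ne')
        (hn i j hj hjl).ne'
    · rw [ray_apply]
      rw [← hq, hM0 i' j hj, hs.eq_zero 0 j hj, mul_zero, mul_zero, sub_zero, mul_zero]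

/-- Genericity is used only for termination. The pass that first succeeds may come before the
asymptotic regime, so the common face is read off from the equality of supports alone. -/
theorem exists_stoppingIndex {J : Finset (Fin L)} {k : ℕ} {s : Fin (k + 2) → Fin L → ℝ}
    (hs : IsAdmissible J s) {x : Fin k → ℝ} (hx : x ∈ cornerSimplex k)
    (hgen : IsGeneric J (s 0) (hullPoint (fun i => s i.succ) x)) :
    ∃ n l, s 0 l ≠ 0 ∧
      stoppingIndex (fun i => mix P (s i)) (hullPoint (fun i => mix P (s i.succ)) x) =
        Part.some n ∧
      candidates (fun i => mix P (s i)) (hullPoint (fun i => mix P (s i.succ)) x) n =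
        Part.some (fun i => mix P (nextSamples s x n l i)) ∧
      IsAdmissible (J.erase l) (nextSamples s x n l) := by
  set q := hullPoint (fun i => s i.succ) x with hq
  have hdom : (Nat.rfind fun t : ℕ => (candidates (fun i => mix P (s i))
      (hullPoint (fun i => mix P (s i.succ)) x) (t + 2)).bind fun R => faceTest R).Dom := by
    obtain ⟨t, ht⟩ := exists_faceTest_eq_true hP hs hx hgen
    refine Nat.rfind_dom.2 ⟨t, ht ▸ Part.mem_some _, fun {m} _ => ?_⟩
    choose l hl using fun i => exists_isMinRatio
      (mixture_mem hs.mem hx (Nat.succ_pos (m + 1)) i) (hs.mem 0)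
    obtain ⟨b, hb, -⟩ := faceTest_candidates hP hs hx (Nat.succ_pos (m + 1)) hl
    rw [hb]
    trivial
  obtain ⟨t, ht⟩ := Part.dom_iff_mem.1 hdom
  have hn : 0 < t + 2 := Nat.succ_pos _
  choose lf hl using fun i => exists_isMinRatio (mixture_mem hs.mem hx hn i) (hs.mem 0)
  obtain ⟨b, hb, hiff⟩ := faceTest_candidates hP hs hx hn hl
  have hspec := Nat.rfind_spec ht
  rw [hb, Part.mem_some_iff] at hspec
  have hsupp := hiff.1 hspec.symm
  have hzero : ∀ i, ray (mixture s q (t + 2) i) (s 0) (lf i) (lf 0) = 0 := fun i =>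
    hsupp 0 i (lf 0) (ray_self _ _ _)
  have hlt := fun i => (hl i).lt (mixture_mem hs.mem hx hn i) (hs.mem 0)
    (mixture_ne hs.li x hn i)
  -- Vanishing of residue i at `lf 0` says that its ratio there equals the minimal one at `lf i`.
  have hmin : ∀ i, IsMinRatio (mixture s q (t + 2) i) (s 0) (lf 0) := fun i => by
    refine ⟨(hl 0).1, fun j => ?_⟩
    have h1 := hzero i
    rw [ray_apply] at h1
    have h2 := (mul_eq_zero.1 h1).resolve_left (inv_ne_zero (sub_pos.2 (hlt i)).ne')
    have h3 := mul_le_mul_of_nonneg_right ((hl i).2 j) (hl 0).1.le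
    refine le_of_mul_le_mul_left ?_ (hl i).1
    linear_combination h3 + s 0 j * h2
  have hlt' := fun i => (hmin i).lt (mixture_mem hs.mem hx hn i) (hs.mem 0)
    (mixture_ne hs.li x hn i)
  refine ⟨t + 2, lf 0, (hl 0).1.ne', ?_, candidates_mix hP hs hx hn hmin, ?_, ?_, ?_⟩
  · rw [stoppingIndex, Part.eq_some_iff.2 ht, Part.map_some]
  · exact fun i => ray_mem_stdSimplex (mixture_mem hs.mem hx hn i) (hs.mem 0)
      (mixture_ne hs.li x hn i) (hmin i)
  · intro i j hj
    by_cases hjl : j = lf 0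
    · rw [hjl]; exact ray_self _ _ _
    · have hjJ : j ∉ J := fun h => hj (Finset.mem_erase.2 ⟨hjl, h⟩)
      simp [nextSamples, ray_apply, mixture, hullPoint_eq_sum, hs.eq_zero _ j hjJ]
  · exact linearIndependent_ray hs.li x hn (fun _ => (hl 0).1.ne') fun i => (hlt' i).ne

theorem demix_two {J : Finset (Fin L)} (hJ : J.card = 2) {s : Fin 2 → Fin L → ℝ}
    (hs : IsAdmissible J s) (u : (k : ℕ) → Fin k → ℝ) :
    ∃ σ : Fin 2 → Fin L, Function.Injective σ ∧ (∀ i, σ i ∈ J) ∧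
      demix u 2 (fun i => mix P (s i)) = Part.some (fun i => signed (P (σ i))) := by
  have hne : s 0 ≠ s 1 := hs.li.injective.ne (by decide)
  obtain ⟨l, hl⟩ := exists_isMinRatio (hs.mem 0) (hs.mem 1)
  obtain ⟨l', hl'⟩ := exists_isMinRatio (hs.mem 1) (hs.mem 0)
  have hlt := hl.lt (hs.mem 0) (hs.mem 1) hne
  have hlt' := hl'.lt (hs.mem 1) (hs.mem 0) hne.symm
  -- The two minimal ratios give opposite strict inequalities between `s 0` and `s 1`, so the
  -- residues drop different vertices of the edge `J`.
  have hll : l' ≠ l := by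
    rintro rfl
    exact lt_asymm hlt hlt'
  have hlJ : l ∈ J := by
    by_contra h
    exact hl.1.ne' (hs.eq_zero 1 l h)
  have hlJ' : l' ∈ J := by
    by_contra h
    exact hl'.1.ne' (hs.eq_zero 0 l' h)
  have hJe : J = {l', l} := by
    refine (Finset.eq_of_subset_of_card_le ?_ ?_).symm
    · intro j hj
      rcases Finset.mem_insert.1 hj with rfl | hj
      · exact hlJ'
      · rwa [Finset.mem_singleton.1 hj]
    · rw [hJ, Finset.card_pair hll]
  have hray : ∀ a b : Fin 2, ∀ p p' : Fin L, (∀ j, j ≠ p' → j ≠ p → j ∉ J) →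
      s a ≠ s b → IsMinRatio (s a) (s b) p →
      residue (mix P (s a)) (mix P (s b)) = Part.some (signed (P p')) := by
    intro a b p p' hpp hab hp
    rw [residue_mix hP (hs.mem a) (hs.mem b) hab hp, ← mix_single, eq_single_of_mem_stdSimplex
      (ray_mem_stdSimplex (hs.mem a) (hs.mem b) hab hp) (l := p')]
    intro j hj
    by_cases hjp : j = p
    · rw [hjp, ray_self]
    · simp [ray_apply, hs.eq_zero _ j (hpp j hj hjp)]
  refine ⟨![l', l], ?_, ?_, ?_⟩
  · intro i j h
    fin_cases i <;> fin_cases j <;> simp_all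
  · intro i
    fin_cases i
    · exact hlJ'
    · exact hlJ
  · rw [demix]
    refine evalAll_some fun i => ?_
    fin_cases i
    · exact hray 0 1 l l' (fun j h1 h2 => by simp [hJe, h1, h2]) hne hl
    · exact hray 1 0 l' l (fun j h1 h2 => by simp [hJe, h1, h2]) hne.symm hl'

theorem demix_succ {J : Finset (Fin L)} {m : ℕ} (hJ : J.card = m + 3)
    {s : Fin (m + 3) → Fin L → ℝ} (hs : IsAdmissible J s) {u : (k : ℕ) → Fin k → ℝ}
    (hx : u (m + 1) ∈ cornerSimplex (m + 1))
    (hgen : IsGeneric J (s 0) (hullPoint (fun i => s i.succ) (u (m + 1))))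
    (hrec : ∀ n l, ∀ J' : Finset (Fin L), J'.card = m + 2 →
      IsAdmissible J' (nextSamples s (u (m + 1)) n l) →
      ∃ σ : Fin (m + 2) → Fin L, Function.Injective σ ∧ (∀ i, σ i ∈ J') ∧
        demix u (m + 2) (fun i => mix P (nextSamples s (u (m + 1)) n l i)) =
          Part.some (fun i => signed (P (σ i)))) :
    ∃ σ : Fin (m + 3) → Fin L, Function.Injective σ ∧ (∀ i, σ i ∈ J) ∧
      demix u (m + 3) (fun i => mix P (s i)) = Part.some (fun i => signed (P (σ i))) := by
  obtain ⟨n, l, hl0, hindex, hcand, hadm⟩ := exists_stoppingIndex hP hs hx hgen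
  have hlJ : l ∈ J := by
    by_contra h
    exact hl0 (hs.eq_zero 0 l h)
  have hcard : (J.erase l).card = m + 2 := by
    rw [Finset.card_erase_of_mem hlJ, hJ]; rfl
  obtain ⟨σ, hσi, hσJ, hσ⟩ := hrec n l _ hcard hadm
  have hσl : ∀ i, σ i ≠ l := fun i => Finset.ne_of_mem_erase (hσJ i)
  have hσs : ∀ j ∈ J.erase l, ∃ i, σ i = j := by
    have : Finset.univ.image σ = J.erase l := by
      refine Finset.eq_of_subset_of_card_le (fun j hj => ?_) ?_
      · obtain ⟨i, -, rfl⟩ := Finset.mem_image.1 hj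
        exact hσJ i
      · rw [hcard, Finset.card_image_of_injective _ hσi, Finset.card_univ, Fintype.card_fin]
    intro j hj
    rw [← this] at hj
    obtain ⟨i, -, hi⟩ := Finset.mem_image.1 hj
    exact ⟨i, hi⟩
  set a : Fin L → ℝ := (1 / ((m + 3 : ℕ) : ℝ)) • ∑ i, s i with ha
  have ham : a ∈ stdSimplex ℝ (Fin L) := by
    rw [ha, Finset.smul_sum]
    refine (convex_stdSimplex ℝ (Fin L)).sum_mem (fun _ _ => by positivity) ?_ fun i _ => hs.mem i
    rw [Finset.sum_const, Finset.card_univ, Fintype.card_fin, nsmul_eq_mul]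
    field_simp
  -- The dropped vertex has positive weight in the sample `s 0`, hence in the mean.
  have hal : a l ≠ 0 := by
    have h1 : 0 < ∑ i, s i l := Finset.sum_pos' (fun i _ => (hs.mem i).1 l)
      ⟨0, Finset.mem_univ _, lt_of_le_of_ne ((hs.mem 0).1 l) hl0.symm⟩
    have h2 : a l = (1 / ((m + 3 : ℕ) : ℝ)) * ∑ i, s i l := by simp [ha]
    rw [h2]
    positivity
  have hres := successiveResidues_mix hP σ l hσl ham hal fun j hj hj' => by
    have hjJ : j ∉ J := fun h => by
      obtain ⟨i, hi⟩ := hσs j (Finset.mem_erase.2 ⟨hj, h⟩)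
      exact hj' i hi
    simp [ha, hs.eq_zero _ j hjJ]
  have hmean : (1 / ((m + 3 : ℕ) : ℝ)) • ∑ i, mix P (s i) = mix P a := by
    rw [ha, map_smul, map_sum]
  refine ⟨Fin.snoc σ l, ?_, ?_, ?_⟩
  · refine Fin.snoc_injective_iff.2 ⟨hσi, ?_⟩
    rintro ⟨i, hi⟩
    exact hσl i hi
  · intro i
    refine Fin.lastCases ?_ (fun i => ?_) i
    · simpa using hlJ
    · simpa using Finset.mem_of_mem_erase (hσJ i)
  · rw [demix, hindex, Part.bind_some, hcand, Part.bind_some, hσ, Part.bind_some, hmean, hres,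
      Part.bind_some]
    congr 1
    funext i
    refine Fin.lastCases ?_ (fun i => ?_) i <;> simp

end Step

/-! ### Genericity holds almost surely. -/

/-- This is the zero set of an affine function whose values at 0 and at the unit vectors are the `y
i`, so it is a proper affine subspace. -/
theorem volume_hullPoint_eq_zero {k : ℕ} {y : Fin (k + 1) → ℝ} (hy : ∃ i, y i ≠ 0) :
    volume {x : Fin k → ℝ | hullPoint y x = 0} = 0 := by
  let A : (Fin k → ℝ) →ᵃ[ℝ] ℝ :=
    (Fintype.linearCombination ℝ (fun i => y i.succ - y 0)).toAffineMap +
      AffineMap.const ℝ (Fin k → ℝ) (y 0)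
  have hA : ∀ x, A x = hullPoint y x := fun x => by
    simp [A, hullPoint, Fintype.linearCombination_apply, mul_sub, sub_mul, Finset.sum_mul]
    ring
  have hset : {x : Fin k → ℝ | hullPoint y x = 0} =
      ((affineSpan ℝ {(0 : ℝ)}).comap A : Set (Fin k → ℝ)) := by
    ext x
    simp [hA]
  rw [hset]
  refine Measure.addHaar_affineSubspace _ _ fun htop => ?_
  have h0 : ∀ x : Fin k → ℝ, hullPoint y x = 0 := fun x => by
    have : x ∈ ((affineSpan ℝ {(0 : ℝ)}).comap A : Set (Fin k → ℝ)) := by rw [htop]; trivial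
    rwa [← hset] at this
  obtain ⟨i, hi⟩ := hy
  revert hi
  refine Fin.cases (fun hi => hi ?_) (fun i hi => hi ?_) i
  · simpa [hullPoint] using h0 0
  · simpa [hullPoint, Pi.single_apply] using h0 (Pi.single i 1)

theorem measurable_hullPoint (k : ℕ) :
    Measurable fun p : (Fin (k + 1) → ℝ) × (Fin k → ℝ) => hullPoint p.1 p.2 := by
  unfold hullPoint
  simp only [smul_eq_mul]
  fun_prop

theorem ae_hullPoint_ne_zero {Ω : Type*} [MeasurableSpace Ω] {μ : Measure Ω}
    [IsProbabilityMeasure μ] {k : ℕ} {V : Ω → Fin (k + 1) → ℝ} {U : Ω → Fin k → ℝ}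
    (hV : Measurable V) (hU : Measurable U) (hind : IndepFun V U μ)
    (hac : μ.map U ≪ volume) :
    ∀ᵐ ω ∂μ, (∃ i, V ω i ≠ 0) → hullPoint (V ω) (U ω) ≠ 0 := by
  set N : Set ((Fin (k + 1) → ℝ) × (Fin k → ℝ)) :=
    {p | (∃ i, p.1 i ≠ 0) ∧ hullPoint p.1 p.2 = 0} with hN
  have hNm : MeasurableSet N := by
    have h : MeasurableSet (⋃ i, {p : (Fin (k + 1) → ℝ) × (Fin k → ℝ) | p.1 i ≠ 0}) :=
      MeasurableSet.iUnion fun i =>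
        (measurableSet_eq_fun (by fun_prop) measurable_const).compl
    convert h.inter (measurable_hullPoint k (measurableSet_singleton 0)) using 1
    ext p
    simp [hN]
  have hprob : IsProbabilityMeasure (μ.map U) := Measure.isProbabilityMeasure_map hU.aemeasurable
  have hnull : (μ.map fun ω => (V ω, U ω)) N = 0 := by
    rw [(indepFun_iff_map_prod_eq_prod_map_map hV.aemeasurable hU.aemeasurable).1 hind,
      Measure.measure_prod_null hNm]
    -- By independence the joint law is a product, so it suffices that each slice at fixed `y` is
    -- null.
    refine Filter.Eventually.of_forall fun y => hac ?_
    by_cases hy : ∃ i, y i ≠ 0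
    · exact measure_mono_null (fun x hx => hx.2) (volume_hullPoint_eq_zero hy)
    · exact measure_mono_null (fun x hx => hy hx.1) measure_empty
  rw [Measure.map_apply (hV.prodMk hU) hNm] at hnull
  filter_upwards [measure_eq_zero_iff_ae_notMem.1 hnull] with ω hω hi h0
  exact hω ⟨hi, h0⟩

/-- As many independent vectors as `J` has elements must span the whole coordinate subspace of `J`.
-/
theorem IsAdmissible.map_single_eq_zero {J : Finset (Fin L)} {k : ℕ} {s : Fin k → Fin L → ℝ}
    (hs : IsAdmissible J s) (hJ : J.card = k) (f : (Fin L → ℝ) →ₗ[ℝ] ℝ) (hf : ∀ i, f (s i) = 0)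
    {j : Fin L} (hj : j ∈ J) : f (Pi.single j 1) = 0 := by
  classical
  set T : Finset (Fin L → ℝ) := J.image fun j => Pi.single j 1 with hT
  have hle : Submodule.span ℝ (Set.range s) ≤ Submodule.span ℝ (T : Set (Fin L → ℝ)) := by
    rw [Submodule.span_le]
    rintro _ ⟨i, rfl⟩
    have : s i = ∑ j ∈ J, s i j • (Pi.single j 1 : Fin L → ℝ) := by
      ext j
      rw [Finset.sum_apply]
      by_cases hj : j ∈ J
      · simp [Pi.single_apply, hj]
      · simp [Pi.single_apply, hj, hs.eq_zero i j hj]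
    rw [this]
    exact Submodule.sum_mem _ fun j hj => Submodule.smul_mem _ _
      (Submodule.subset_span (Finset.mem_coe.2 (Finset.mem_image_of_mem _ hj)))
  have heq : Submodule.span ℝ (Set.range s) = Submodule.span ℝ (T : Set (Fin L → ℝ)) := by
    refine Submodule.eq_of_le_of_finrank_le hle ?_
    rw [finrank_span_eq_card hs.li, Fintype.card_fin, ← hJ]
    exact (finrank_span_finset_le_card T).trans Finset.card_image_le
  have hker : Submodule.span ℝ (Set.range s) ≤ LinearMap.ker f := by
    rw [Submodule.span_le]
    rintro _ ⟨i, rfl⟩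
    exact hf i
  exact hker (heq ▸ Submodule.subset_span (Finset.mem_coe.2 (Finset.mem_image_of_mem _ hj)))

/-- The functional v ↦ a_l v_j - v_l a_j, with a = `s 0`, kills `s 0`. If it killed every other
sample it would kill the vertex j, where its value is a_l. -/
theorem IsAdmissible.exists_ne_zero {J : Finset (Fin L)} {k : ℕ} {s : Fin (k + 1) → Fin L → ℝ}
    (hs : IsAdmissible J s) (hJ : J.card = k + 1) {l j : Fin L} (hj : j ∈ J) (hlj : l ≠ j)
    (hl : s 0 l ≠ 0) : ∃ i : Fin k, s 0 l * s i.succ j - s i.succ l * s 0 j ≠ 0 := by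
  by_contra! h
  let f : (Fin L → ℝ) →ₗ[ℝ] ℝ := s 0 l • LinearMap.proj j - s 0 j • LinearMap.proj l
  have hf : ∀ v, f v = s 0 l * v j - v l * s 0 j := fun v => by simp [f, mul_comm]
  have := hs.map_single_eq_zero hJ f (fun i => by
    rw [hf]
    refine Fin.cases ?_ (fun i => h i) i
    ring) hj
  rw [hf] at this
  simp [hlj, hl] at this

theorem measurable_nextSamples {k : ℕ} (n : ℕ) (l : Fin L) :
    Measurable fun p : (Fin (k + 2) → Fin L → ℝ) × (Fin k → ℝ) => nextSamples p.1 p.2 n l := by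
  refine measurable_pi_lambda _ fun i => measurable_pi_lambda _ fun j => ?_
  have hm : ∀ j : Fin L, Measurable fun p : (Fin (k + 2) → Fin L → ℝ) × (Fin k → ℝ) =>
      mixture p.1 (hullPoint (fun i => p.1 i.succ) p.2) n i j := by
    intro j
    simp only [mixture, hullPoint, Pi.add_apply, Pi.smul_apply, Finset.sum_apply, smul_eq_mul]
    fun_prop
  simp only [nextSamples, ray_apply]
  have h1 := hm j
  have h2 := hm l
  fun_prop

/-! ### Induction along the random tape. -/

section Tape

variable {Ω : Type*} [MeasurableSpace Ω] {μ : Measure Ω} [IsProbabilityMeasure μ]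
  {U : (k : ℕ) → Ω → Fin k → ℝ}

/-- Outer calls have more arguments and read tape entries of larger index. Measurability of `S` with
respect to those entries therefore encodes its independence of the present draw. -/
theorem ae_isGeneric (hU : ∀ k, Measurable (U k)) (hindep : iIndepFun U μ) {k : ℕ}
    (hac : μ.map (U k) ≪ volume) {S : Ω → Fin (k + 2) → Fin L → ℝ}
    (hS : Measurable[⨆ i ∈ Set.Ioi k, MeasurableSpace.comap (U i) inferInstance] S) :
    ∀ᵐ ω ∂μ, ∀ J : Finset (Fin L), J.card = k + 2 → IsAdmissible J (S ω) →
      IsGeneric J (S ω 0) (hullPoint (fun i => S ω i.succ) (U k ω)) := by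
  have hle : ∀ i, MeasurableSpace.comap (U i) inferInstance ≤ ‹MeasurableSpace Ω› :=
    fun i => (hU i).comap_le
  have hInd : Indep (⨆ i ∈ Set.Ioi k, MeasurableSpace.comap (U i) inferInstance)
      (MeasurableSpace.comap (U k) inferInstance) μ := by
    have := indep_iSup_of_disjoint hle hindep (S := Set.Ioi k) (T := {k}) (by simp)
    simpa using this
  have key : ∀ l j : Fin L, ∀ᵐ ω ∂μ,
      (∃ i : Fin (k + 1), S ω 0 l * S ω i.succ j - S ω i.succ l * S ω 0 j ≠ 0) →
      hullPoint (fun i : Fin (k + 1) => S ω 0 l * S ω i.succ j - S ω i.succ l * S ω 0 j)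
        (U k ω) ≠ 0 := by
    intro l j
    have hg : Measurable fun (s : Fin (k + 2) → Fin L → ℝ) (i : Fin (k + 1)) =>
        s 0 l * s i.succ j - s i.succ l * s 0 j := by fun_prop
    have hV := hg.comp hS
    have hV' := hV.mono (iSup₂_le fun i _ => hle i) le_rfl
    exact ae_hullPoint_ne_zero hV' (hU k) (indep_of_indep_of_le_left hInd hV.comap_le) hac
  filter_upwards [ae_all_iff.2 fun l => ae_all_iff.2 (key l)] with ω hω J hJ hs l hl j hj hlj h0
  have h1 := hω l j (hs.exists_ne_zero hJ hj hlj h0)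
  let f : (Fin L → ℝ) →ₗ[ℝ] ℝ := S ω 0 l • LinearMap.proj j - S ω 0 j • LinearMap.proj l
  have hf : ∀ v, f v = S ω 0 l * v j - v l * S ω 0 j := fun v => by simp [f, mul_comm]
  rw [← hf, map_hullPoint]
  simpa only [hf] using h1

/-- The stopping index and the dropped vertex are random. The induction hypothesis is applied to
every fixed pair `(n, l)` and the countably many null sets are united, so no measurability of the
stopping rule is needed. -/
theorem ae_demix {P : Fin L → ProbabilityMeasure X} (hP : JointlyIrreducible P)
    (hU : ∀ k, Measurable (U k)) (hindep : iIndepFun U μ)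
    (hunif : ∀ k, pdf.IsUniform (U k) (cornerSimplex k) μ volume) (m : ℕ)
    {S : Ω → Fin (m + 2) → Fin L → ℝ}
    (hS : Measurable[⨆ i ∈ Set.Ioi m, MeasurableSpace.comap (U i) inferInstance] S) :
    ∀ᵐ ω ∂μ, ∀ J : Finset (Fin L), J.card = m + 2 → IsAdmissible J (S ω) →
      ∃ σ : Fin (m + 2) → Fin L, Function.Injective σ ∧ (∀ i, σ i ∈ J) ∧
        demix (fun k => U k ω) (m + 2) (fun i => mix P (S ω i)) =
          Part.some (fun i => signed (P (σ i))) := by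
  induction m with
  | zero => exact Filter.Eventually.of_forall fun ω J hJ hs => demix_two hP hJ hs _
  | succ m ih =>
    have hmem : ∀ᵐ ω ∂μ, U (m + 1) ω ∈ cornerSimplex (m + 1) := by
      have h := hunif (m + 1)
      have hclosed : MeasurableSet (cornerSimplex (m + 1)) := by
        unfold cornerSimplex
        measurability
      refine ae_of_ae_map (hU _).aemeasurable ?_
      rw [show μ.map (U (m + 1)) = _ from h]
      exact ae_cond_mem hclosed
    have hac : μ.map (U (m + 1)) ≪ volume := by
      rw [show μ.map (U (m + 1)) = _ from hunif (m + 1)]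
      exact cond_absolutelyContinuous
    have hnext : ∀ n l, Measurable[⨆ i ∈ Set.Ioi m, MeasurableSpace.comap (U i) inferInstance]
        (fun ω => nextSamples (S ω) (U (m + 1) ω) n l) := by
      intro n l
      have h1 : Measurable[⨆ i ∈ Set.Ioi m, MeasurableSpace.comap (U i) inferInstance] S :=
        hS.mono (biSup_mono fun i hi => (Nat.lt_succ_self m).trans hi) le_rfl
      have h2 : Measurable[⨆ i ∈ Set.Ioi m, MeasurableSpace.comap (U i) inferInstance]
          (U (m + 1)) := by
        rw [measurable_iff_comap_le]
        exact le_iSup₂_of_le (m + 1) (Nat.lt_succ_self m) le_rfl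
      exact (measurable_nextSamples n l).comp (h1.prodMk h2)
    filter_upwards [hmem, ae_isGeneric hU hindep hac hS,
      ae_all_iff.2 fun n => ae_all_iff.2 fun l => ih (hnext n l)] with ω h1 h2 h3 J hJ hs
    exact demix_succ hP hJ hs h1 (h2 J hJ hs) h3

end Tape

end Demix

/-- The random tape `U` consists of independent draws, the one in dimension `k` being uniform on
`{x ∈ ℝᵏ : x ≥ 0, ∑ xᵢ ≤ 1}`. -/
theorem theorem9 {X : Type*} [MeasurableSpace X] {Ω : Type*} [MeasurableSpace Ω]
    (μ : Measure Ω) [IsProbabilityMeasure μ]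
    (U : (k : ℕ) → Ω → Fin k → ℝ) (hU : ∀ k, Measurable (U k))
    (hUunif : ∀ k, pdf.IsUniform (U k) (Demix.cornerSimplex k) μ volume)
    (hUindep : iIndepFun U μ)
    (L : ℕ) (hL : 2 ≤ L)
    (P : Fin L → ProbabilityMeasure X) (hP : Demix.JointlyIrreducible P)
    (π : Fin L → Fin L → ℝ) (hπ : ∀ i, π i ∈ stdSimplex ℝ (Fin L))
    (hπli : LinearIndependent ℝ π) :
    ∀ᵐ ω ∂μ, ∃ σ : Equiv.Perm (Fin L),
      Demix.demix (fun k => U k ω) L (fun i => ∑ j, π i j • Demix.signed (P j)) =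
        Part.some (fun i => Demix.signed (P (σ i))) := by
  obtain ⟨m, rfl⟩ := Nat.exists_eq_add_of_le' hL
  filter_upwards [Demix.ae_demix hP hU hUindep hUunif m
    (@measurable_const _ _ _ (⨆ i ∈ Set.Ioi m, MeasurableSpace.comap (U i) inferInstance) π)]
    with ω hω
  obtain ⟨σ, hσ, -, h⟩ := hω Finset.univ (by simp) ⟨hπ, by simp, hπli⟩
  exact ⟨Equiv.ofBijective σ (Finite.injective_iff_bijective.1 hσ), h⟩
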